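/- \textbf{Setting.} Fix a dimension $d$ and a real $\rho$. Let $w\ge 1$ and $\gamma\ge 0$ be integers, let $P$ be a set of $n$ points with integer coordinates in $\{0,\dots,2^w-1\}^d$, and let $S\subseteq\mathbb R^d$ be a connected set that contains $P$ (for instance the cube $[0,2^w-1]^d$, or a connected surface). The restricted Voronoi cell $V_p$ of $p\in P$ is the set of $x\in S$ with $|px|\le|qx|$ for all $q\in P$. The set $P$ is \emph{$\rho$-well-spaced} in $S$ if $|px|\le\rho\,|pq|$ for all $p\in P$, $x\in V_p$ and $q\in P\setminus\{p\}$. \textbf{Balanced quadtree.} A square of height $h\ge0$ is a half-open cube of side (size) $2^h$ whose minimum corner has coordinates divisible by $2^h$; splitting it, which is possible if $h\ge1$, yields its $2^d$ children of height $h-1$. Two squares are neighbours if their closures meet but their interiors do not. A square is crowded if it contains at least two points of $P$, or if it contains exactly one and an equal-sized neighbour contains at least one. A square of the tree is unbalanced if some neighbouring square of the tree has one quarter of its size. The balanced quadtree of $P$ is obtained from the root $[0,2^w)^d$ by splitting crowded or unbalanced leaves of height at least $1$ as long as there are any. For $p\in P$ let $h(p)$ be the height of the leaf that contains $p$. \textbf{Rounding.}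 The rounded point $p'$ is obtained from $p$ by replacing the lower $\max(h(p)-\gamma,0)$ bits of each coordinate by zeroes. List $P$ as $p_1,\dots,p_n$ in Morton order, that is, by increasing value of the integer that interleaves the bits of the coordinates; write $h_i=h(p_i)$ and $k_i=\max(h_i-\gamma,0)$. \textbf{Storage scheme.} The gamma code of a natural number $m$ is the single bit $1$ if $m=0$; otherwise it consists of as many zeroes as $m$ has binary digits, followed by these digits. The gamma code of an integer is that of its absolute value, followed by a sign bit unless it is zero. Store $h_1$ and the $d$ coordinates of $p_1'$ with $w$ bits each. For $i=2,\dots,n$ in turn, append the gamma code of the difference $h_i-h_{i-1}$, and then, for each $j=1,\dots,d$, the gamma code of $(p'_{i,j}\ \mathbf{xor}\ p'_{i-1,j})\gg k_i$, where $\gg$ is the right shift. \textbf{Theorem.} There is a constant $C$ that depends only on $\rho$ and $d$ such that, for all $w,\gamma,S,P$ as above with $P$ $\rho$-well-spaced in $S$: \begin{itemize} \item the list $(h_1,p_1'),\dots,(h_n,p_n')$ is recovered from the stored bits (given $d,w,\gamma$) by decoding them in sequence: for $i\ge2$, decode the height difference and add it to $h_{i-1}$ to obtain $h_i$; then decode each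 shifted xor, and combine it by xor with $p'_{i-1,j}\gg k_i$; shift the result left by $k_i$ to obtain $p'_{i,j}$; \item the number of stored bits is at most $C\,(w+n\max(\gamma,1))$. Thus it is $O(w+n\gamma)$ for $\gamma\ge1$, and $O(w+n)$ for $\gamma=0$. \end{itemize} -/

import Mathlib

/-! Points have natural-number coordinates; on a `w`-bit machine every coordinate is below `2 ^ w`. -/

/-- A point with integer coordinates, seen in Euclidean space. -/
noncomputable def toEuclid {d : ℕ} (p : Fin d → ℕ) : EuclideanSpace ℝ (Fin d) :=
  WithLp.toLp 2 (fun i => (p i : ℝ))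

/-- The (closed) Voronoi cell of `p` with respect to `P`, restricted to `S`. -/
def voronoiCell {d : ℕ} (S : Set (EuclideanSpace ℝ (Fin d))) (P : Finset (Fin d → ℕ))
    (p : Fin d → ℕ) : Set (EuclideanSpace ℝ (Fin d)) :=
  {x | x ∈ S ∧ ∀ q ∈ P, dist x (toEuclid p) ≤ dist x (toEuclid q)}

/-- `P` is `ρ`-well-spaced in `S`: for all `p ∈ P`, the maximal distance from `p` to a point of its
restricted Voronoi cell is at most `ρ` times the distance from `p` to its nearest other point. -/
def WellSpaced {d : ℕ} (S : Set (EuclideanSpace ℝ (Fin d))) (ρ : ℝ)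
    (P : Finset (Fin d → ℕ)) : Prop :=
  ∀ p ∈ P, ∀ x ∈ voronoiCell S P p, ∀ q ∈ P, q ≠ p →
    dist (toEuclid p) x ≤ ρ * dist (toEuclid p) (toEuclid q)

/-! ### The balanced quadtree -/

/-- A square of the trie of arity `2 ^ d`: the half-open cube of side `2 ^ height` whose minimum
corner is `2 ^ height` times `index`. -/
structure Square (d : ℕ) where
  height : ℕ
  index : Fin d → ℕ

namespace Square

variable {d : ℕ}

/-- The side length. -/
def size (s : Square d) : ℕ := 2 ^ s.height

/-- The minimum corner. -/
def corner (s : Square d) (i : Fin d) : ℕ := s.size * s.index i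

/-- The points of `P` that lie in the square. -/
def vertices (s : Square d) (P : Finset (Fin d → ℕ)) : Finset (Fin d → ℕ) :=
  P.filter (fun p => ∀ i, s.corner i ≤ p i ∧ p i < s.corner i + s.size)

/-- Two squares are neighbours if their closures meet (possibly only in a corner) and their
interiors do not. A square has at most `3 ^ d - 1` neighbours of its own size. -/
def Neighbour (s t : Square d) : Prop :=
  (∀ i, s.corner i ≤ t.corner i + t.size ∧ t.corner i ≤ s.corner i + s.size) ∧
  (∃ i, s.corner i + s.size ≤ t.corner i ∨ t.corner i + t.size ≤ s.corner i)

/-- `c` is one of the `2 ^ d` squares into which `s` is split. -/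
def IsChild (c s : Square d) : Prop :=
  c.height + 1 = s.height ∧ ∀ i, c.index i / 2 = s.index i

/-- `s` contains two or more vertices, or it contains exactly one and an equal-sized neighbour
contains one or more. -/
def Crowded (P : Finset (Fin d → ℕ)) (s : Square d) : Prop :=
  2 ≤ (s.vertices P).card ∨
  ((s.vertices P).card = 1 ∧
    ∃ t : Square d, t.height = s.height ∧ Neighbour s t ∧ (t.vertices P).Nonempty)

end Square

/-- The squares (internal ones and leaves) of the balanced quadtree over `P`: starting from the
root square `[0, 2 ^ w) ^ d`, squares that are crowded, or unbalanced (some neighbouring square of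
the tree has one quarter of their size), are split as long as there are any. A split is never undone
and never removes the reason for another one, so its order does not matter. Squares of size `1` have
no children: coordinates are integers, and the depth of the tree is at most `w`. -/
inductive IsTreeSquare {d : ℕ} (w : ℕ) (P : Finset (Fin d → ℕ)) : Square d → Prop
  | root : IsTreeSquare w P ⟨w, fun _ => 0⟩
  | splitCrowded (s c : Square d) : IsTreeSquare w P s → s.Crowded P → c.IsChild s →
      IsTreeSquare w P c
  | splitUnbalanced (s t c : Square d) : IsTreeSquare w P s → IsTreeSquare w P t →
      t.height + 2 = s.height → s.Neighbour t → c.IsChild s → IsTreeSquare w P c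

/-- A leaf of the balanced quadtree: a square of the tree that is not split. -/
def IsLeafSquare {d : ℕ} (w : ℕ) (P : Finset (Fin d → ℕ)) (s : Square d) : Prop :=
  IsTreeSquare w P s ∧ ∀ c : Square d, c.IsChild s → ¬ IsTreeSquare w P c

theorem Square.mem_vertices {d : ℕ} {s : Square d} {P : Finset (Fin d → ℕ)} {p : Fin d → ℕ} :
    p ∈ s.vertices P ↔ p ∈ P ∧ ∀ i, p i / 2 ^ s.height = s.index i := by
  have h : 0 < 2 ^ s.height := by positivity
  unfold Square.vertices Square.corner Square.size
  rw [Finset.mem_filter]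
  refine and_congr_right fun _ => forall_congr' fun i => ?_
  rw [Nat.div_eq_iff h]
  constructor
  · rintro ⟨h1, h2⟩
    constructor
    · nlinarith
    · have : p i < s.index i * 2 ^ s.height + 2 ^ s.height := by linarith
      omega
  · rintro ⟨h1, h2⟩
    constructor
    · nlinarith
    · have : p i < s.index i * 2 ^ s.height + 2 ^ s.height := by omega
      linarith

/-- A square of the tree is the root, or it is a child of a square all of whose children are in the
tree. -/
theorem IsTreeSquare.eq_root_or {d w : ℕ} {P : Finset (Fin d → ℕ)} {c : Square d}
    (hc : IsTreeSquare w P c) : c = ⟨w, fun _ => 0⟩ ∨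
      ∃ s, IsTreeSquare w P s ∧ c.IsChild s ∧ ∀ c' : Square d, c'.IsChild s → IsTreeSquare w P c' := by
  cases hc with
  | root => exact Or.inl rfl
  | splitCrowded s c hs h hcs => exact Or.inr ⟨s, hs, hcs, fun c' h' => .splitCrowded s c' hs h h'⟩
  | splitUnbalanced s t c hs ht h1 h2 hcs =>
    exact Or.inr ⟨s, hs, hcs, fun c' h' => .splitUnbalanced s t c' hs ht h1 h2 h'⟩

theorem existsUnique_leaf {d w : ℕ} {P : Finset (Fin d → ℕ)} {p : Fin d → ℕ} (hp : p ∈ P)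
    (hw : ∀ i, p i < 2 ^ w) : ∃! s : Square d, IsLeafSquare w P s ∧ p ∈ s.vertices P := by
  classical
  let sq : ℕ → Square d := fun k => ⟨k, fun i => p i / 2 ^ k⟩
  have hsq : ∀ s : Square d, p ∈ s.vertices P → s = sq s.height := by
    rintro ⟨k, a⟩ h
    simp only [sq, Square.mk.injEq, true_and]
    exact funext fun i => ((Square.mem_vertices.1 h).2 i).symm
  have hmem : ∀ k, p ∈ (sq k).vertices P := fun k => Square.mem_vertices.2 ⟨hp, fun _ => rfl⟩
  have hchild : ∀ k, (sq k).IsChild (sq (k + 1)) := fun k =>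
    ⟨rfl, fun i => by simp only [sq, pow_succ, Nat.div_div_eq_div_mul]⟩
  have hroot : sq w = ⟨w, fun _ => 0⟩ := by
    simp only [sq, Square.mk.injEq, true_and]
    exact funext fun i => Nat.div_eq_of_lt (hw i)
  have hex : ∃ k, IsTreeSquare w P (sq k) := ⟨w, hroot ▸ .root⟩
  have hle : ∀ c : Square d, IsTreeSquare w P c → c.height ≤ w := by
    intro c hc
    induction hc with
    | root => exact le_rfl
    | splitCrowded s c _ _ h ih => have := h.1; omega
    | splitUnbalanced s t c _ _ _ _ h ih _ => have := h.1; omega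
  have hup : ∀ k, k < w → IsTreeSquare w P (sq k) → IsTreeSquare w P (sq (k + 1)) := by
    intro k hk h
    rcases h.eq_root_or with h | ⟨s, hs, hcs, -⟩
    · have : k = w := congrArg Square.height h
      omega
    · have : s = sq (k + 1) := by
        obtain ⟨m, a⟩ := s
        have h1 : k + 1 = m := hcs.1
        subst h1
        simp only [sq, Square.mk.injEq, true_and]
        exact funext fun i => (hcs.2 i).symm.trans ((hchild k).2 i)
      exact this ▸ hs
  have hup' : ∀ j k, k ≤ j → j ≤ w → IsTreeSquare w P (sq k) → IsTreeSquare w P (sq j) := by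
    intro j k hkj
    induction j, hkj using Nat.le_induction with
    | base => exact fun _ h => h
    | succ j _ ih => exact fun hj h => hup j (by omega) (ih (by omega) h)
  have hleaf : IsLeafSquare w P (sq (Nat.find hex)) := by
    refine ⟨Nat.find_spec hex, fun c hc hct => ?_⟩
    rcases hct.eq_root_or with h | ⟨s, -, hcs, hall⟩
    · have h1 := hle _ (Nat.find_spec hex)
      have h2 : c.height + 1 = Nat.find hex := hc.1
      have h3 : c.height = w := congrArg Square.height h
      simp only [sq] at h1
      omega
    · have hh : s = sq (Nat.find hex) := by
        have h1 := hc.1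
        have h2 := hcs.1
        obtain ⟨m, a⟩ := s
        have h3 : m = Nat.find hex := h2.symm.trans h1
        subst h3
        simp only [sq, Square.mk.injEq, true_and]
        exact funext fun i => (hcs.2 i).symm.trans (hc.2 i)
      have h2 : c.height + 1 = Nat.find hex := hc.1
      have h3 := hchild c.height
      rw [h2, ← hh] at h3
      exact Nat.find_min hex (m := c.height) (by omega) (hall _ h3)
  refine ⟨sq (Nat.find hex), ⟨hleaf, hmem _⟩, ?_⟩
  rintro s ⟨hs, hps⟩
  have hs' := hsq s hps
  rcases (Nat.find_min' hex (hs' ▸ hs.1)).eq_or_lt with h | h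
  · rw [hs', h]
  · exfalso
    have hw' := hle _ hs.1
    refine hs.2 (sq (s.height - 1)) ?_ (hup' _ _ (by omega) (by omega) (Nat.find_spec hex))
    have h3 := hchild (s.height - 1)
    rw [show s.height - 1 + 1 = s.height by omega] at h3
    exact hs' ▸ h3

/-- The height of the leaf of the balanced quadtree over `P` that contains the vertex `p`. (There is
exactly one such leaf, see `existsUnique_leaf`.) -/
noncomputable def leafHeight {d : ℕ} (w : ℕ) (P : Finset (Fin d → ℕ)) (p : Fin d → ℕ) : ℕ :=
  sInf {h | ∃ s : Square d, IsLeafSquare w P s ∧ p ∈ s.vertices P ∧ s.height = h}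

/-! ### Rounding and the Morton order -/

/-- Zero out the lower `h - γ` bits of each coordinate (none of them if `h ≤ γ`). -/
def roundPoint {d : ℕ} (γ h : ℕ) (p : Fin d → ℕ) : Fin d → ℕ :=
  fun i => (p i >>> (h - γ)) <<< (h - γ)

/-- The integer of `d * w` bits that interleaves the bits of the coordinates, from the most to the
least significant bits, and from the first to the last coordinate among bits of equal weight. -/
def mortonNumber {d : ℕ} (w : ℕ) (p : Fin d → ℕ) : ℕ :=
  ∑ b ∈ Finset.range w, ∑ i : Fin d,
    if (p i).testBit b then 2 ^ (d * b + (d - 1 - (i : ℕ))) else 0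

/-- The points of `P`, sorted by Morton number. -/
noncomputable def mortonSort {d : ℕ} (w : ℕ) (P : Finset (Fin d → ℕ)) : List (Fin d → ℕ) :=
  P.toList.mergeSort (fun p q => decide (mortonNumber w p ≤ mortonNumber w q))

/-- The rounded set `P'` in Morton order, each rounded point together with its leaf height. -/
noncomputable def roundedArray {d : ℕ} (w γ : ℕ) (P : Finset (Fin d → ℕ)) :
    List (ℕ × (Fin d → ℕ)) :=
  (mortonSort w P).map fun p => (leafHeight w P p, roundPoint γ (leafHeight w P p) p)

/-! ### The codes -/

/-- The `w` low bits of `x`, most significant first. -/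
def natBits (w x : ℕ) : List Bool := (List.range w).map fun b => x.testBit (w - 1 - b)

/-- The number with the given binary digits, most significant first. -/
def bitsToNat (l : List Bool) : ℕ := l.foldl (fun a b => 2 * a + b.toNat) 0

/-- Gamma code of a natural number: its number of bits in unary, using zeroes, then the number from
its leading `1` on; zero is coded as a single `1`. -/
def gammaNat (x : ℕ) : List Bool :=
  if x = 0 then [true] else List.replicate x.size false ++ natBits x.size x

/-- Gamma code of an integer: that of its absolute value, then a sign bit unless it is zero. -/
def gammaInt (z : ℤ) : List Bool :=
  gammaNat z.natAbs ++ if z = 0 then [] else [decide (z < 0)]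

/-- Read one gamma-coded natural number; return it with the remaining bits. -/
def readGammaNat (l : List Bool) : ℕ × List Bool :=
  let z := (l.takeWhile fun b => !b).length
  if z = 0 then (0, l.drop 1)
  else (bitsToNat ((l.drop z).take z), l.drop (2 * z))

/-- Read one gamma-coded integer. -/
def readGammaInt (l : List Bool) : ℤ × List Bool :=
  let (m, r) := readGammaNat l
  if m = 0 then (0, r)
  else (if r.headD false then -(m : ℤ) else (m : ℤ), r.drop 1)

/-- Read `k` values, one after the other, with the reader `f`. -/
def readMany (f : List Bool → ℕ × List Bool) : ℕ → List Bool → List ℕ × List Bool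
  | 0, l => ([], l)
  | k + 1, l =>
    let (x, r) := f l
    let (xs, r') := readMany f k r
    (x :: xs, r')

/-- Code of an entry `(h', x')` of the array whose predecessor is `(h, x)`: the height difference,
then the shifted xor of each coordinate. -/
def encodeNext {d : ℕ} (γ : ℕ) (prev cur : ℕ × (Fin d → ℕ)) : List Bool :=
  gammaInt ((cur.1 : ℤ) - (prev.1 : ℤ)) ++
    (List.finRange d).flatMap fun j => gammaNat ((cur.2 j ^^^ prev.2 j) >>> (cur.1 - γ))

/-- Code of the entries that follow `prev`. -/
def encodeTail {d : ℕ} (γ : ℕ) : ℕ × (Fin d → ℕ) → List (ℕ × (Fin d → ℕ)) → List Bool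
  | _, [] => []
  | prev, cur :: l => encodeNext γ prev cur ++ encodeTail γ cur l

/-- Code of an array of heights and points: the first entry in longhand, `w` bits for each number,
then each further entry relative to its predecessor. -/
def encodeArray {d : ℕ} (w γ : ℕ) : List (ℕ × (Fin d → ℕ)) → List Bool
  | [] => []
  | a :: l => natBits w a.1 ++ (List.finRange d).flatMap (fun j => natBits w (a.2 j)) ++
      encodeTail γ a l

/-- Decode an entry, given its predecessor: add the difference to the previous height to obtain the
height `h`; shift the previous coordinates right by `h - γ`, xor, and shift left by `h - γ`. -/
def decodeNext {d : ℕ} (γ : ℕ) (prev : ℕ × (Fin d → ℕ)) (l : List Bool) :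
    (ℕ × (Fin d → ℕ)) × List Bool :=
  let (z, r) := readGammaInt l
  let h := ((prev.1 : ℤ) + z).toNat
  let (δ, r') := readMany readGammaNat d r
  ((h, fun j => ((prev.2 j >>> (h - γ)) ^^^ δ.getD j 0) <<< (h - γ)), r')

/-- Decode entries until no bits remain; the first argument bounds their number. -/
def decodeTail {d : ℕ} (γ : ℕ) : ℕ → ℕ × (Fin d → ℕ) → List Bool → List (ℕ × (Fin d → ℕ))
  | 0, _, _ => []
  | _ + 1, _, [] => []
  | k + 1, prev, b :: l =>
    let (cur, r) := decodeNext γ prev (b :: l)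
    cur :: decodeTail γ k cur r

/-- Decode an array of heights and points. It is a function of the stored bits and of the
parameters `d`, `w`, `γ` alone. -/
def decodeArray (d w γ : ℕ) (l : List Bool) : List (ℕ × (Fin d → ℕ)) :=
  if l = [] then [] else
    let readWord : List Bool → ℕ × List Bool := fun m => (bitsToNat (m.take w), m.drop w)
    let (h, r) := readWord l
    let (x, r') := readMany readWord d r
    let a : ℕ × (Fin d → ℕ) := (h, fun j => x.getD j 0)
    a :: decodeTail γ r'.length a r'

/-- The bits that are stored for `P`. -/
noncomputable def storedBits {d : ℕ} (w γ : ℕ) (P : Finset (Fin d → ℕ)) : List Bool :=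
  encodeArray w γ (roundedArray w γ P)

/-!
Decoding inverts encoding since the gamma codes are prefix-free and the rounded coordinates have
zeroes in their lower bits. The leaf of a point contains no other point, so it lies below the lowest
common ancestor, in the trie of squares, of the point and any other one. Consecutive points
`p` and `q` of the Morton order agree in all bits from the height `m` of their lowest common
ancestor upwards, so the entry of `q` takes `O(γ + 1)` bits plus a constant number of bits for every
level between `m` and the two leaves (`length_encodeNext_le`).

It remains to count these levels. Fix a height `k`. The points of a square are contiguous in the
Morton order (`div_eq_of_mortonNumber_between`), so the squares of height `k` that lie between the
leaf and the lowest common ancestor, for the various consecutive pairs, are distinct. A leaf below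
the root stems from a split which is caused, directly or through unbalanced squares, by two points
nearby (`IsTreeSquare.exists_pair_near`), so each of these squares contains a point `p` whose
nearest-neighbour distance `δ p` is `O(2 ^ k)`.

Let `p` be such a point. If `P` is contained in the ball of radius `2 ^ k` around `p`, there are only
`O(1)` squares, which adds up to `O(w)` over all heights. Otherwise the connected set `S` leaves the
ball, and the distance to `p` maps it onto a superset of `[0, 2 ^ k]`. As `S` is covered by the
Voronoi cells, and the cell of `a` has radius at most `ρ * δ a`, the sum of `2 * ρ * δ a` over the
points `a` near `p` is at least `2 ^ k` (`le_sum_diameters`). Each `a` is near `O(1)` squares and has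
`δ a = O(2 ^ k)`, so the number of squares is at most a constant times the sum of `δ a / 2 ^ k` over
the `a` with `δ a = O(2 ^ k)` (`card_level_le`). Over all heights, each `a` contributes a geometric
series of sum `O(1)` (`sum_card_levels_le`), which makes `O(w + n)` levels in total.
-/

/-! ### Decoding inverts encoding -/

theorem natBits_succ (w x : ℕ) : natBits (w + 1) x = natBits w (x / 2) ++ [x.testBit 0] := by
  unfold natBits
  rw [List.range_succ, List.map_append]
  congr 1
  · refine List.map_congr_left fun b hb => ?_
    rw [List.mem_range] at hb
    rw [show w + 1 - 1 - b = (w - 1 - b) + 1 by omega, Nat.testBit_succ]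
  · simp

@[simp] theorem length_natBits (w x : ℕ) : (natBits w x).length = w := by simp [natBits]

theorem bitsToNat_natBits (w x : ℕ) (h : x < 2 ^ w) : bitsToNat (natBits w x) = x := by
  induction w generalizing x with
  | zero => simp [natBits, bitsToNat]; omega
  | succ w ih =>
    have h1 := ih (x / 2) (by rw [pow_succ] at h; omega)
    rw [natBits_succ]
    unfold bitsToNat at h1 ⊢
    rw [List.foldl_append, h1]
    simp only [List.foldl_cons, List.foldl_nil, Nat.testBit_zero]
    rcases Nat.mod_two_eq_zero_or_one x with h2 | h2 <;> simp [h2] <;> omega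

/-- The binary digits start with a one, which ends the run of zeroes in the gamma code. -/
theorem natBits_size {x : ℕ} (hx : x ≠ 0) : ∃ l, natBits x.size x = true :: l := by
  have hs : 0 < x.size := Nat.size_pos.2 (Nat.pos_of_ne_zero hx)
  obtain ⟨s, hs'⟩ : ∃ s, x.size = s + 1 := ⟨x.size - 1, by omega⟩
  have h1 : 2 ^ s ≤ x := Nat.lt_size.1 (by omega)
  have h2 : x < 2 ^ (s + 1) := hs' ▸ Nat.lt_size_self x
  have h3 : x.testBit s = true := by
    obtain ⟨i, hi, hb⟩ := Nat.exists_ge_and_testBit_of_ge_two_pow h1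
    have : i < s + 1 := by
      by_contra hcon
      have := Nat.testBit_lt_two_pow (h2.trans_le (Nat.pow_le_pow_right two_pos (not_lt.1 hcon)))
      simp [this] at hb
    obtain rfl : i = s := by omega
    exact hb
  rw [hs', natBits, List.range_succ_eq_map]
  simp [h3]

theorem readGammaNat_gammaNat (x : ℕ) (r : List Bool) :
    readGammaNat (gammaNat x ++ r) = (x, r) := by
  unfold gammaNat
  split_ifs with hx
  · simp [readGammaNat, hx]
  · have hs : x.size ≠ 0 := (Nat.size_pos.2 (Nat.pos_of_ne_zero hx)).ne'
    obtain ⟨l, hl⟩ := natBits_size hx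
    have hz : (List.takeWhile (fun b => !b)
        ((List.replicate x.size false ++ natBits x.size x) ++ r)).length = x.size := by
      rw [List.append_assoc, List.takeWhile_append_of_pos (by simp), hl]
      simp
    unfold readGammaNat
    simp only [hz, if_neg hs]
    rw [List.append_assoc, List.drop_left' (by simp), List.take_left' (by simp),
      bitsToNat_natBits _ _ (Nat.lt_size_self x), ← List.append_assoc,
      List.drop_left' (by simp [two_mul])]

theorem readGammaInt_gammaInt (z : ℤ) (r : List Bool) :
    readGammaInt (gammaInt z ++ r) = (z, r) := by
  unfold gammaInt readGammaInt
  rw [List.append_assoc, readGammaNat_gammaNat]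
  by_cases hz : z = 0
  · simp [hz]
  · by_cases h : z < 0
    · simp [hz, h, abs_of_neg h]
    · simp [hz, h, abs_of_nonneg (not_lt.1 h)]

theorem readMany_flatMap {α : Type*} (f : List Bool → ℕ × List Bool) (e : ℕ → List Bool)
    (g : α → ℕ) (l : List α) (r : List Bool) (h : ∀ j ∈ l, ∀ r, f (e (g j) ++ r) = (g j, r)) :
    readMany f l.length (l.flatMap (fun j => e (g j)) ++ r) = (l.map g, r) := by
  induction l with
  | nil => simp [readMany]
  | cons a l ih =>
    have h1 := h a (by simp)
    have h2 := ih fun j hj => h j (by simp [hj])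
    simp [readMany, h1, h2]

theorem readMany_finRange {d : ℕ} (f : List Bool → ℕ × List Bool) (e : ℕ → List Bool)
    (g : Fin d → ℕ) (r : List Bool) (h : ∀ j, ∀ r, f (e (g j) ++ r) = (g j, r)) :
    readMany f d ((List.finRange d).flatMap (fun j => e (g j)) ++ r) =
      ((List.finRange d).map g, r) := by
  simpa using readMany_flatMap f e g (List.finRange d) r fun j _ => h j

theorem getD_map_finRange {d : ℕ} (g : Fin d → ℕ) (j : Fin d) :
    ((List.finRange d).map g).getD j 0 = g j := by
  simp [List.getD_eq_getElem?_getD]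

theorem decodeNext_encodeNext {d : ℕ} (γ : ℕ) (prev cur : ℕ × (Fin d → ℕ)) (r : List Bool)
    (h : ∀ j, (cur.2 j >>> (cur.1 - γ)) <<< (cur.1 - γ) = cur.2 j) :
    decodeNext γ prev (encodeNext γ prev cur ++ r) = (cur, r) := by
  unfold encodeNext decodeNext
  rw [List.append_assoc, readGammaInt_gammaInt]
  simp only
  rw [readMany_finRange readGammaNat gammaNat
    (fun j => (cur.2 j ^^^ prev.2 j) >>> (cur.1 - γ)) r fun j r => readGammaNat_gammaNat _ r]
  have h1 : ((prev.1 : ℤ) + ((cur.1 : ℤ) - (prev.1 : ℤ))).toNat = cur.1 := by omega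
  simp only [h1, getD_map_finRange]
  refine Prod.ext (Prod.ext rfl (funext fun j => ?_)) rfl
  simp only
  rw [Nat.shiftRight_xor_distrib, Nat.xor_comm (cur.2 j >>> _), ← Nat.xor_assoc, Nat.xor_self,
    Nat.zero_xor, h]

theorem gammaNat_ne_nil (x : ℕ) : gammaNat x ≠ [] := by
  unfold gammaNat
  split_ifs with h
  · simp
  · have : x.size ≠ 0 := (Nat.size_pos.2 (Nat.pos_of_ne_zero h)).ne'
    simp [this]

/-- So the number of remaining bits bounds the number of remaining entries, as `decodeTail`
requires. -/
theorem encodeNext_ne_nil {d : ℕ} (γ : ℕ) (prev cur : ℕ × (Fin d → ℕ)) :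
    encodeNext γ prev cur ≠ [] := by
  simp [encodeNext, gammaInt, gammaNat_ne_nil]

theorem decodeTail_encodeTail {d : ℕ} (γ : ℕ) (l : List (ℕ × (Fin d → ℕ)))
    (prev : ℕ × (Fin d → ℕ)) (n : ℕ) (hn : (encodeTail γ prev l).length ≤ n)
    (h : ∀ a ∈ l, ∀ j, (a.2 j >>> (a.1 - γ)) <<< (a.1 - γ) = a.2 j) :
    decodeTail γ n prev (encodeTail γ prev l) = l := by
  induction l generalizing prev n with
  | nil => cases n <;> simp [encodeTail, decodeTail]
  | cons a l ih =>
    obtain ⟨b, t, hbt⟩ := List.exists_cons_of_ne_nil (encodeNext_ne_nil γ prev a)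
    have h1 := decodeNext_encodeNext γ prev a (encodeTail γ a l) (h a (by simp))
    rw [encodeTail] at hn ⊢
    rw [hbt, List.cons_append] at h1 hn ⊢
    simp only [List.length_cons, List.length_append] at hn
    obtain ⟨m, rfl⟩ : ∃ m, n = m + 1 := ⟨n - 1, by omega⟩
    simp only [decodeTail, h1]
    rw [ih a m (by omega) fun c hc => h c (by simp [hc])]

/-- The hypotheses say that the first entry fits into words of `w` bits, and that the coordinates
of all later entries are rounded according to their heights. -/
theorem decodeArray_encodeArray {d : ℕ} (w γ : ℕ) (hw : 1 ≤ w) (l : List (ℕ × (Fin d → ℕ)))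
    (hh : ∀ a ∈ l, a.1 < 2 ^ w) (hx : ∀ a ∈ l, ∀ j, a.2 j < 2 ^ w)
    (h : ∀ a ∈ l, ∀ j, (a.2 j >>> (a.1 - γ)) <<< (a.1 - γ) = a.2 j) :
    decodeArray d w γ (encodeArray w γ l) = l := by
  cases l with
  | nil => simp [encodeArray, decodeArray]
  | cons a l =>
    have key : ∀ x, x < 2 ^ w → ∀ r : List Bool,
        (bitsToNat ((natBits w x ++ r).take w), (natBits w x ++ r).drop w) = (x, r) := by
      intro x hx r
      rw [List.take_left' (by simp), List.drop_left' (by simp), bitsToNat_natBits _ _ hx]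
    have hne : encodeArray w γ (a :: l) ≠ [] := by
      intro h0
      have := congrArg List.length h0
      simp [encodeArray] at this
      omega
    unfold decodeArray
    rw [if_neg hne]
    simp only [encodeArray, List.append_assoc, List.take_left' (length_natBits w a.1),
      List.drop_left' (length_natBits w a.1), bitsToNat_natBits w a.1 (hh a (by simp))]
    rw [readMany_finRange (fun m => (bitsToNat (m.take w), m.drop w)) (natBits w) a.2 _
      fun j r => key _ (hx a (by simp) j) r]
    simp only [getD_map_finRange, Prod.mk.eta]
    rw [decodeTail_encodeTail γ l a _ le_rfl fun b hb => h b (by simp [hb])]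

/-! ### Code lengths -/

theorem length_gammaNat_le (x : ℕ) : (gammaNat x).length ≤ 2 * x.size + 1 := by
  unfold gammaNat
  split_ifs <;> simp
  omega

theorem length_gammaInt_le (z : ℤ) : (gammaInt z).length ≤ 2 * z.natAbs.size + 2 := by
  have := length_gammaNat_le z.natAbs
  unfold gammaInt
  split_ifs <;> simp <;> omega

theorem length_flatMap_le {α β : Type*} (l : List α) (f : α → List β) (B : ℕ)
    (h : ∀ j ∈ l, (f j).length ≤ B) : (l.flatMap f).length ≤ l.length * B := by
  rw [List.length_flatMap]
  simpa using List.sum_le_card_nsmul (l.map fun j => (f j).length) B (by simpa using h)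

theorem length_encodeTail {d : ℕ} (γ : ℕ) (l : List (ℕ × (Fin d → ℕ))) (a z : ℕ × (Fin d → ℕ)) :
    (encodeTail γ a l).length = ∑ i ∈ Finset.range l.length,
      (encodeNext γ ((a :: l).getD i z) ((a :: l).getD (i + 1) z)).length := by
  induction l generalizing a with
  | nil => simp [encodeTail]
  | cons b l ih =>
    rw [encodeTail, List.length_append, ih b, List.length_cons, Finset.sum_range_succ',
      add_comm]
    simp

/-! ### Leaves of the balanced quadtree -/

theorem IsTreeSquare.height_le {d w : ℕ} {P : Finset (Fin d → ℕ)} {c : Square d}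
    (hc : IsTreeSquare w P c) : c.height ≤ w := by
  induction hc with
  | root => exact le_rfl
  | splitCrowded s c _ _ h ih => have := h.1; omega
  | splitUnbalanced s t c _ _ _ _ h ih _ => have := h.1; omega

theorem Square.IsChild.corner_bounds {d : ℕ} {c s : Square d} (h : c.IsChild s) :
    s.size = 2 * c.size ∧ ∀ i, s.corner i ≤ c.corner i ∧ c.corner i ≤ s.corner i + c.size := by
  have h1 : s.size = 2 * c.size := by
    unfold Square.size
    rw [← h.1, pow_succ, mul_comm]
  refine ⟨h1, fun i => ?_⟩
  have h2 := h.2 i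
  unfold Square.corner
  rw [h1]
  constructor
  · nlinarith [show 2 * s.index i ≤ c.index i by omega]
  · nlinarith [show c.index i ≤ 2 * s.index i + 1 by omega]

/-- The split of the parent of `c` is caused by a crowded square, either by the parent itself or
through a chain of unbalanced squares. The sizes halve along the chain, so the distances add up to
a multiple of the size of `c`. -/
theorem IsTreeSquare.exists_pair_near {d w : ℕ} {P : Finset (Fin d → ℕ)} {c : Square d}
    (hc : IsTreeSquare w P c) : c.height = w ∨ ∃ a ∈ P, ∃ b ∈ P, a ≠ b ∧
      ∀ q, q = a ∨ q = b → ∀ i, q i ≤ c.corner i + 8 * c.size ∧ c.corner i ≤ q i + 8 * c.size := by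
  induction hc with
  | root => exact Or.inl rfl
  | splitCrowded s c hs hcr hch _ =>
    right
    obtain ⟨hsz, hco⟩ := hch.corner_bounds
    have hmem : ∀ {t : Square d} {q}, q ∈ t.vertices P →
        q ∈ P ∧ ∀ i, t.corner i ≤ q i ∧ q i < t.corner i + t.size := fun h =>
      Finset.mem_filter.1 h
    rcases hcr with h | ⟨h, t, hts, hn, b, hb⟩
    · obtain ⟨a, ha, b, hb, hab⟩ := Finset.one_lt_card.1 h
      refine ⟨a, (hmem ha).1, b, (hmem hb).1, hab, ?_⟩
      rintro q (rfl | rfl) i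
      · have := (hmem ha).2 i
        have := hco i
        omega
      · have := (hmem hb).2 i
        have := hco i
        omega
    · obtain ⟨a, ha⟩ := Finset.card_pos.1 (h ▸ one_pos)
      have hts' : t.size = s.size := by simp [Square.size, hts]
      refine ⟨a, (hmem ha).1, b, (hmem hb).1, ?_, ?_⟩
      · rintro rfl
        obtain ⟨i, hi⟩ := hn.2
        have := (hmem ha).2 i
        have := (hmem hb).2 i
        omega
      · rintro q (rfl | rfl) i
        · have := (hmem ha).2 i
          have := hco i
          omega
        · have := (hmem hb).2 i
          have := hco i
          have := hn.1 i
          omega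
  | splitUnbalanced s t c hs ht h2 hn hch _ iht =>
    right
    obtain ⟨hsz, hco⟩ := hch.corner_bounds
    have hsw := hs.height_le
    have hch1 := hch.1
    have hct : c.size = 2 * t.size := by
      unfold Square.size
      rw [show c.height = t.height + 1 by omega, pow_succ, mul_comm]
    rcases iht with h | ⟨a, ha, b, hb, hab, h⟩
    · omega
    · refine ⟨a, ha, b, hb, hab, fun q hq i => ?_⟩
      have := h q hq i
      have := hco i
      have := hn.1 i
      omega

section Leaf

variable {d w : ℕ} {P : Finset (Fin d → ℕ)} {p : Fin d → ℕ}

theorem exists_leaf (hp : p ∈ P) (hw : ∀ i, p i < 2 ^ w) :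
    ∃ s : Square d, IsLeafSquare w P s ∧ p ∈ s.vertices P ∧ s.height = leafHeight w P p := by
  obtain ⟨s, ⟨h1, h2⟩, -⟩ := existsUnique_leaf hp hw
  exact Nat.sInf_mem
    (s := {h | ∃ s : Square d, IsLeafSquare w P s ∧ p ∈ s.vertices P ∧ s.height = h})
    ⟨s.height, s, h1, h2, rfl⟩

theorem leafHeight_le (hp : p ∈ P) (hw : ∀ i, p i < 2 ^ w) : leafHeight w P p ≤ w := by
  obtain ⟨s, h1, -, h3⟩ := exists_leaf hp hw
  exact h3 ▸ h1.1.height_le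

/-- A leaf of positive height is not crowded, so it contains no other point. -/
theorem leafHeight_le_of_div_eq (hp : p ∈ P) (hw : ∀ i, p i < 2 ^ w) {q : Fin d → ℕ}
    (hq : q ∈ P) (hpq : p ≠ q) {m : ℕ} (hm : ∀ i, p i / 2 ^ m = q i / 2 ^ m) :
    leafHeight w P p ≤ m := by
  obtain ⟨s, h1, h2, h3⟩ := exists_leaf hp hw
  by_contra! hlt
  have hps := Square.mem_vertices.1 h2
  have hqs : q ∈ s.vertices P := by
    refine Square.mem_vertices.2 ⟨hq, fun i => ?_⟩
    rw [← hps.2 i, show s.height = m + (s.height - m) by omega, pow_add,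
      ← Nat.div_div_eq_div_mul, ← Nat.div_div_eq_div_mul, hm i]
  have hcr : s.Crowded P := Or.inl (Finset.one_lt_card.2 ⟨p, h2, q, hqs, hpq⟩)
  have hch : Square.IsChild ⟨s.height - 1, fun i => 2 * s.index i⟩ s :=
    ⟨by simp only; omega, fun i => by simp⟩
  exact h1.2 _ hch (.splitCrowded s _ h1.1 hcr hch)

/-- The nearest neighbour of a point is at most at a distance of the order of the size of the point's
leaf, unless the leaf is the root. -/
theorem exists_near_of_leafHeight_lt (hp : p ∈ P) (hw : ∀ i, p i < 2 ^ w)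
    (h : leafHeight w P p < w) : ∃ q ∈ P, q ≠ p ∧ ∀ i,
      q i ≤ p i + 9 * 2 ^ leafHeight w P p ∧ p i ≤ q i + 9 * 2 ^ leafHeight w P p := by
  obtain ⟨s, h1, h2, h3⟩ := exists_leaf hp hw
  rcases h1.1.exists_pair_near with h4 | ⟨a, ha, b, hb, hab, h4⟩
  · omega
  · have hps := (Finset.mem_filter.1 h2).2
    have hsz : s.size = 2 ^ leafHeight w P p := by rw [← h3]; rfl
    rw [← hsz]
    have key : ∀ q, q = a ∨ q = b → ∀ i, q i ≤ p i + 9 * s.size ∧ p i ≤ q i + 9 * s.size := by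
      intro q hq i
      have := h4 q hq i
      have := hps i
      omega
    by_cases hap : a = p
    · exact ⟨b, hb, fun hbp => hab (hap.trans hbp.symm), key b (Or.inr rfl)⟩
    · exact ⟨a, ha, hap, key a (Or.inl rfl)⟩

end Leaf

/-! ### Distances between grid points -/

theorem dist_toEuclid_le {d : ℕ} {p q : Fin d → ℕ} {B : ℕ}
    (h : ∀ i, q i ≤ p i + B ∧ p i ≤ q i + B) : dist (toEuclid p) (toEuclid q) ≤ d * B := by
  rw [EuclideanSpace.dist_eq]
  refine Real.sqrt_le_iff.2 ⟨by positivity, ?_⟩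
  have h1 : ∀ i ∈ Finset.univ, dist (toEuclid p i) (toEuclid q i) ^ 2 ≤ (B : ℝ) ^ 2 := by
    intro i _
    refine pow_le_pow_left₀ dist_nonneg ?_ 2
    have h2 : (q i : ℝ) ≤ p i + B := by exact_mod_cast (h i).1
    have h3 : (p i : ℝ) ≤ q i + B := by exact_mod_cast (h i).2
    rw [Real.dist_eq]
    exact abs_le.2 ⟨by simp only [toEuclid]; linarith, by simp only [toEuclid]; linarith⟩
  refine (Finset.sum_le_card_nsmul _ _ _ h1).trans ?_
  rw [Finset.card_univ, Fintype.card_fin, nsmul_eq_mul, mul_pow]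
  have : (d : ℝ) ≤ (d : ℝ) ^ 2 := by exact_mod_cast Nat.le_self_pow two_ne_zero d
  gcongr

theorem le_add_of_dist_toEuclid_le {d : ℕ} {p q : Fin d → ℕ} {B : ℕ}
    (h : dist (toEuclid p) (toEuclid q) ≤ B) (i : Fin d) : p i ≤ q i + B := by
  have h1 : |toEuclid p i - toEuclid q i| ≤ B := by
    rw [← Real.dist_eq]
    exact (PiLp.dist_apply_le (toEuclid p) (toEuclid q) i).trans h
  have h2 := (abs_le.1 h1).2
  simp only [toEuclid] at h2
  have : (p i : ℝ) ≤ q i + B := by linarith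
  exact_mod_cast this

/-! ### Packing and covering -/

/-- At most `5 ^ d` squares of side `2 ^ k` contain a point within distance `2 * 2 ^ k` of `a`:
each coordinate of the index differs by at most `2`. -/
theorem card_le_five_pow {ι : Type*} {d : ℕ} {J : Finset ι} (g : ι → Fin d → ℕ) (k : ℕ)
    (a : Fin d → ℕ)
    (hinj : ∀ i ∈ J, ∀ j ∈ J, (∀ c, g i c / 2 ^ k = g j c / 2 ^ k) → i = j)
    (hnear : ∀ i ∈ J, dist (toEuclid a) (toEuclid (g i)) ≤ 2 * 2 ^ k) : J.card ≤ 5 ^ d := by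
  let T : Finset (Fin d → ℕ) := Fintype.piFinset fun c =>
    Finset.Icc (a c / 2 ^ k - 2) (a c / 2 ^ k + 2)
  have hT : T.card ≤ 5 ^ d := by
    rw [Fintype.card_piFinset]
    refine (Finset.prod_le_pow_card _ _ 5 fun c _ => ?_).trans (by simp)
    rw [Nat.card_Icc]
    omega
  have hdiv : ∀ x y : ℕ, x ≤ y + 2 * 2 ^ k → x / 2 ^ k ≤ y / 2 ^ k + 2 := fun x y h => by
    have := Nat.div_le_div_right (c := 2 ^ k) h
    rwa [Nat.add_mul_div_right _ _ (by positivity)] at this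
  refine (Finset.card_le_card_of_injOn (fun i c => g i c / 2 ^ k) ?_ ?_).trans hT
  · intro i hi
    refine Finset.mem_coe.2 (Fintype.mem_piFinset.2 fun c => ?_)
    change g i c / 2 ^ k ∈ Finset.Icc _ _
    have h0 : dist (toEuclid a) (toEuclid (g i)) ≤ ((2 * 2 ^ k : ℕ) : ℝ) := by
      push_cast
      exact hnear i hi
    have h1 := hdiv _ _ (le_add_of_dist_toEuclid_le h0 c)
    have h2 := hdiv _ _ (le_add_of_dist_toEuclid_le ((dist_comm _ _).trans_le h0) c)
    exact Finset.mem_Icc.2 ⟨Nat.sub_le_iff_le_add.2 h1, h2⟩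
  · intro i hi j hj h
    exact hinj i hi j hj fun c => congrFun h c

/-- A connected set that contains two points at distance at least `L` is projected by the distance
to one of them onto a superset of `[0, L]`; hence the cells that it meets within distance `L` of
that point have diameters of sum at least `L`. The radius of the cell of `a` is `R a`. -/
theorem le_sum_diameters {X α : Type*} [PseudoMetricSpace X] {S : Set X} (hS : IsPreconnected S)
    (P : Finset α) (e : α → X) (R : α → ℝ) (hR : ∀ a ∈ P, 0 ≤ R a)
    (hcell : ∀ a ∈ P, ∀ x ∈ S, (∀ b ∈ P, dist x (e a) ≤ dist x (e b)) → dist x (e a) ≤ R a)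
    {p q : α} (hp : p ∈ P) (hpS : e p ∈ S) (hqS : e q ∈ S) {L : ℝ} (hL : L ≤ dist (e p) (e q)) :
    L ≤ ∑ a ∈ P.filter (fun a => dist (e a) (e p) ≤ 2 * L), 2 * R a := by
  have hcov : Set.Icc 0 L ⊆ ⋃ a ∈ P.filter (fun a => dist (e a) (e p) ≤ 2 * L),
      Set.Icc (dist (e a) (e p) - R a) (dist (e a) (e p) + R a) := by
    intro r hr
    have himg : IsPreconnected ((fun x => dist x (e p)) '' S) :=
      hS.image _ (by fun_prop)
    obtain ⟨x, hxS, hx⟩ := himg.Icc_subset ⟨e p, hpS, dist_self _⟩ ⟨e q, hqS, rfl⟩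
      (show r ∈ Set.Icc 0 (dist (e q) (e p)) from ⟨hr.1, by rw [dist_comm]; exact hr.2.trans hL⟩)
    obtain ⟨a, ha, hmin⟩ := P.exists_min_image (fun a => dist x (e a)) ⟨p, hp⟩
    have h1 := hcell a ha x hxS hmin
    have h2 := hmin p hp
    have h3 := dist_triangle_left (e a) (e p) x
    have h4 := dist_triangle x (e a) (e p)
    simp only at hx
    simp only [Set.mem_iUnion]
    refine ⟨a, Finset.mem_filter.2 ⟨ha, ?_⟩, ?_, ?_⟩
    · linarith [hr.2]
    · linarith
    · linarith
  have hvol := (MeasureTheory.measure_mono (μ := MeasureTheory.volume) hcov).trans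
    (MeasureTheory.measure_biUnion_finset_le _ _)
  have hnonneg : ∀ a ∈ P.filter (fun a => dist (e a) (e p) ≤ 2 * L), 0 ≤ 2 * R a := fun a ha =>
    mul_nonneg two_pos.le (hR a (Finset.mem_filter.1 ha).1)
  simp only [Real.volume_Icc] at hvol
  rw [← ENNReal.ofReal_le_ofReal_iff (Finset.sum_nonneg hnonneg),
    ENNReal.ofReal_sum_of_nonneg hnonneg]
  refine (le_of_eq (by rw [sub_zero])).trans (hvol.trans (Finset.sum_le_sum fun a _ => ?_))
  exact ENNReal.ofReal_le_ofReal (by linarith)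

/-- If there are two points or more, then nearest-neighbour distances `δ` exist. -/
theorem exists_nearest {d : ℕ} {P : Finset (Fin d → ℕ)} (hP : 1 < P.card) :
    ∃ δ : (Fin d → ℕ) → ℝ, (∀ p, 0 ≤ δ p) ∧ ∀ p ∈ P,
      (∃ q ∈ P, q ≠ p ∧ dist (toEuclid p) (toEuclid q) = δ p) ∧
      ∀ q ∈ P, q ≠ p → δ p ≤ dist (toEuclid p) (toEuclid q) := by
  classical
  have h : ∀ p, ∃ q, p ∈ P → (q ∈ P ∧ q ≠ p ∧
      ∀ q' ∈ P, q' ≠ p → dist (toEuclid p) (toEuclid q) ≤ dist (toEuclid p) (toEuclid q')) := by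
    intro p
    obtain ⟨q, hq, hqp⟩ := Finset.exists_mem_ne hP p
    obtain ⟨a, ha, hmin⟩ := (P.erase p).exists_min_image
      (fun a => dist (toEuclid p) (toEuclid a)) ⟨q, Finset.mem_erase.2 ⟨hqp, hq⟩⟩
    rw [Finset.mem_erase] at ha
    exact ⟨a, fun _ => ⟨ha.2, ha.1, fun q' h1 h2 => hmin q' (Finset.mem_erase.2 ⟨h2, h1⟩)⟩⟩
  choose f hf using h
  refine ⟨fun p => dist (toEuclid p) (toEuclid (f p)), fun p => dist_nonneg, fun p hp => ?_⟩
  obtain ⟨h1, h2, h3⟩ := hf p hp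
  exact ⟨⟨f p, h1, h2, rfl⟩, h3⟩

/-- Points in distinct squares of side `2 ^ k` whose nearest-neighbour distances `δ` are of order
`2 ^ k` at most: their number is bounded by the sum of the nearest-neighbour distances of that order
relative to `2 ^ k`, up to a constant. -/
theorem card_level_le {ι : Type*} {d : ℕ} {P : Finset (Fin d → ℕ)}
    {S : Set (EuclideanSpace ℝ (Fin d))} (hS : IsPreconnected S) (hPS : ∀ p ∈ P, toEuclid p ∈ S)
    {ρ : ℝ} (hρ : 0 ≤ ρ) {δ : (Fin d → ℕ) → ℝ} (hδ : ∀ p, 0 ≤ δ p)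
    (hmin : ∀ p ∈ P, ∀ q ∈ P, q ≠ p → δ p ≤ dist (toEuclid p) (toEuclid q))
    (hcell : ∀ p ∈ P, ∀ x ∈ voronoiCell S P p, dist x (toEuclid p) ≤ ρ * δ p)
    {B : ℝ} (hB : 2 ≤ B) (k : ℕ) (J : Finset ι) (g : ι → Fin d → ℕ) (hg : ∀ i ∈ J, g i ∈ P)
    (hgδ : ∀ i ∈ J, δ (g i) ≤ B * 2 ^ k)
    (hinj : ∀ i ∈ J, ∀ j ∈ J, (∀ c, g i c / 2 ^ k = g j c / 2 ^ k) → i = j) :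
    (J.card : ℝ) ≤ 5 ^ d +
      5 ^ d * (2 * ρ) * ∑ a ∈ P, if δ a ≤ B * 2 ^ k then δ a / 2 ^ k else 0 := by
  classical
  have hk : (0 : ℝ) < 2 ^ k := by positivity
  have hsum : 0 ≤ ∑ a ∈ P, if δ a ≤ B * 2 ^ k then δ a / 2 ^ k else 0 :=
    Finset.sum_nonneg fun a _ => by
      have := hδ a
      split_ifs <;> positivity
  -- Either all of `P` is near one of the points, or the connected set leaves the ball of radius
  -- `2 ^ k` around each of them, and every point pays for at most `5 ^ d` balls.
  by_cases hall : ∃ i ∈ J, ∀ q ∈ P, dist (toEuclid (g i)) (toEuclid q) ≤ 2 ^ k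
  · obtain ⟨i, hi, hq⟩ := hall
    have h1 := card_le_five_pow g k (g i) hinj fun j hj =>
      (hq _ (hg j hj)).trans (by linarith)
    have h2 : (J.card : ℝ) ≤ 5 ^ d := by exact_mod_cast h1
    have : 0 ≤ (5 : ℝ) ^ d * (2 * ρ) *
      ∑ a ∈ P, if δ a ≤ B * 2 ^ k then δ a / 2 ^ k else 0 := by positivity
    linarith
  · push Not at hall
    let F : (Fin d → ℕ) → ℝ := fun a => if δ a ≤ B * 2 ^ k then δ a / 2 ^ k else 0
    have hF : ∀ a, 0 ≤ F a := fun a => by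
      have := hδ a
      simp only [F]
      split_ifs <;> positivity
    have h1 : ∀ i ∈ J, (1 : ℝ) ≤
        ∑ a ∈ P, if dist (toEuclid a) (toEuclid (g i)) ≤ 2 * 2 ^ k then 2 * ρ * F a else 0 := by
      intro i hi
      obtain ⟨q, hq, hlt⟩ := hall i hi
      have h2 := le_sum_diameters hS P toEuclid (fun a => ρ * δ a)
        (fun a _ => mul_nonneg hρ (hδ a)) (fun a ha x hx h => hcell a ha x ⟨hx, h⟩)
        (hg i hi) (hPS _ (hg i hi)) (hPS q hq) hlt.le
      rw [Finset.sum_filter] at h2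
      rw [← div_le_div_iff_of_pos_right hk, div_self hk.ne', Finset.sum_div] at h2
      refine h2.trans (Finset.sum_le_sum fun a ha => ?_)
      split_ifs with hnear
      · have hle : δ a ≤ B * 2 ^ k := by
          by_cases hag : a = g i
          · exact hag ▸ hgδ i hi
          · have := hmin a ha (g i) (hg i hi) (Ne.symm hag)
            nlinarith
        simp only [F, if_pos hle]
        exact le_of_eq (by ring)
      · simp
    calc (J.card : ℝ) = ∑ i ∈ J, (1 : ℝ) := by simp
      _ ≤ ∑ i ∈ J, ∑ a ∈ P,
          if dist (toEuclid a) (toEuclid (g i)) ≤ 2 * 2 ^ k then 2 * ρ * F a else 0 :=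
        Finset.sum_le_sum h1
      _ = ∑ a ∈ P, ((J.filter fun i =>
          dist (toEuclid a) (toEuclid (g i)) ≤ 2 * 2 ^ k).card : ℝ) * (2 * ρ * F a) := by
        rw [Finset.sum_comm]
        refine Finset.sum_congr rfl fun a _ => ?_
        rw [← Finset.sum_filter, Finset.sum_const, nsmul_eq_mul]
      _ ≤ ∑ a ∈ P, 5 ^ d * (2 * ρ * F a) := by
        refine Finset.sum_le_sum fun a _ =>
          mul_le_mul_of_nonneg_right ?_ (mul_nonneg (by positivity) (hF a))
        have := card_le_five_pow (J := J.filter fun i =>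
          dist (toEuclid a) (toEuclid (g i)) ≤ 2 * 2 ^ k) g k a
          (fun i hi j hj => hinj i (Finset.mem_filter.1 hi).1 j (Finset.mem_filter.1 hj).1)
          fun i hi => (Finset.mem_filter.1 hi).2
        exact_mod_cast this
      _ = 5 ^ d * (2 * ρ) * ∑ a ∈ P, F a := by
        rw [Finset.mul_sum]
        exact Finset.sum_congr rfl fun a _ => by ring
      _ ≤ _ := by
        have : (0 : ℝ) ≤ 5 ^ d := by positivity
        linarith

/-- Only the terms with `2 ^ k ≥ x / B` are nonzero, and they decrease geometrically from at
most `B` (from `x`, if `k = 0` is the first of them). The minimum makes the induction on `w` go through. -/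
theorem sum_geometric_le {B x : ℝ} (hB : 0 ≤ B) (hx : 0 ≤ x) (w : ℕ) :
    ∑ k ∈ Finset.range w, (if x ≤ B * 2 ^ k then x / 2 ^ k else 0) ≤ 2 * min x B := by
  induction w generalizing x with
  | zero => simp [hx, hB]
  | succ w ih =>
    have h1 := ih (x := x / 2) (by positivity)
    have h2 : ∑ k ∈ Finset.range w,
        (if x ≤ B * 2 ^ (k + 1) then x / 2 ^ (k + 1) else 0) =
        ∑ k ∈ Finset.range w, (if x / 2 ≤ B * 2 ^ k then x / 2 / 2 ^ k else 0) := by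
      refine Finset.sum_congr rfl fun k _ => ?_
      have h3 : x ≤ B * 2 ^ (k + 1) ↔ x / 2 ≤ B * 2 ^ k := by
        rw [pow_succ, div_le_iff₀ two_pos, mul_assoc]
      have h4 : x / 2 ^ (k + 1) = x / 2 / 2 ^ k := by rw [pow_succ', div_div]
      simp only [h3, h4]
    rw [Finset.sum_range_succ', h2]
    simp only [pow_zero, mul_one, div_one]
    split_ifs with h
    · rw [min_eq_left h]
      linarith [min_le_left (x / 2) B]
    · rw [min_eq_right (not_le.1 h).le]
      linarith [min_le_right (x / 2) B]

/-- Summing the bounds of `card_level_le` over all levels, each point contributes a geometric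
series. -/
theorem sum_card_levels_le {ι : Type*} {d : ℕ} {P : Finset (Fin d → ℕ)}
    {S : Set (EuclideanSpace ℝ (Fin d))} (hS : IsPreconnected S) (hPS : ∀ p ∈ P, toEuclid p ∈ S)
    {ρ : ℝ} (hρ : 0 ≤ ρ) {δ : (Fin d → ℕ) → ℝ} (hδ : ∀ p, 0 ≤ δ p)
    (hmin : ∀ p ∈ P, ∀ q ∈ P, q ≠ p → δ p ≤ dist (toEuclid p) (toEuclid q))
    (hcell : ∀ p ∈ P, ∀ x ∈ voronoiCell S P p, dist x (toEuclid p) ≤ ρ * δ p)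
    {B : ℝ} (hB : 2 ≤ B) (w : ℕ) (J : ℕ → Finset ι) (g : ι → Fin d → ℕ)
    (hg : ∀ k < w, ∀ i ∈ J k, g i ∈ P)
    (hgδ : ∀ k < w, ∀ i ∈ J k, δ (g i) ≤ B * 2 ^ k)
    (hinj : ∀ k < w, ∀ i ∈ J k, ∀ j ∈ J k, (∀ c, g i c / 2 ^ k = g j c / 2 ^ k) → i = j) :
    ((∑ k ∈ Finset.range w, (J k).card : ℕ) : ℝ) ≤ 5 ^ d * w + 5 ^ d * (4 * ρ * B) * P.card := by
  push_cast
  have h1 : ∀ k ∈ Finset.range w, ((J k).card : ℝ) ≤ 5 ^ d +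
      5 ^ d * (2 * ρ) * ∑ a ∈ P, if δ a ≤ B * 2 ^ k then δ a / 2 ^ k else 0 := fun k hk => by
    rw [Finset.mem_range] at hk
    exact card_level_le hS hPS hρ hδ hmin hcell hB k (J k) g (hg k hk) (hgδ k hk) (hinj k hk)
  refine (Finset.sum_le_sum h1).trans ?_
  rw [Finset.sum_add_distrib, ← Finset.mul_sum, Finset.sum_comm]
  have h2 : ∑ a ∈ P, ∑ k ∈ Finset.range w, (if δ a ≤ B * 2 ^ k then δ a / 2 ^ k else 0) ≤
      P.card • (2 * B) := by
    refine Finset.sum_le_card_nsmul _ _ _ fun a _ => ?_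
    exact (sum_geometric_le (by linarith) (hδ a) w).trans (by linarith [min_le_right (δ a) B])
  rw [nsmul_eq_mul] at h2
  have h3 : (0 : ℝ) ≤ 5 ^ d * (2 * ρ) := by positivity
  have h4 := mul_le_mul_of_nonneg_left h2 h3
  simp only [Finset.sum_const, Finset.card_range, nsmul_eq_mul]
  linarith

/-! ### The Morton order -/

/-- The bits of one weight, interleaved, are the binary digits of a number below `2 ^ d`. -/
theorem exists_finset_sum_two_pow {d : ℕ} (b : Fin d → Bool) :
    ∃ s : Finset ℕ, (∀ x ∈ s, x < d) ∧
      ∑ i : Fin d, (if b i then 2 ^ (d - 1 - (i : ℕ)) else 0) = ∑ x ∈ s, 2 ^ x ∧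
      ∀ i : Fin d, d - 1 - (i : ℕ) ∈ s ↔ b i = true := by
  have hinj : ∀ i j : Fin d, d - 1 - (i : ℕ) = d - 1 - (j : ℕ) → i = j := fun i j h => by
    have := i.2
    have := j.2
    exact Fin.ext (by omega)
  refine ⟨(Finset.univ.filter fun i => b i = true).image fun i : Fin d => d - 1 - (i : ℕ),
    ?_, ?_, ?_⟩
  · intro x hx
    obtain ⟨i, -, rfl⟩ := Finset.mem_image.1 hx
    have := i.2
    omega
  · rw [Finset.sum_image fun i _ j _ h => hinj i j h, Finset.sum_filter]
  · intro i
    simp only [Finset.mem_image, Finset.mem_filter, Finset.mem_univ, true_and]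
    exact ⟨fun ⟨j, hj, h⟩ => hinj j i h ▸ hj, fun h => ⟨i, h, rfl⟩⟩

theorem mortonNumber_succ {d : ℕ} (w : ℕ) (p : Fin d → ℕ) :
    mortonNumber (w + 1) p = mortonNumber w (fun i => p i / 2) * 2 ^ d +
      ∑ i : Fin d, (if (p i).testBit 0 then 2 ^ (d - 1 - (i : ℕ)) else 0) := by
  unfold mortonNumber
  rw [Finset.sum_range_succ', Finset.sum_mul]
  congr 1
  · refine Finset.sum_congr rfl fun b _ => ?_
    rw [Finset.sum_mul]
    refine Finset.sum_congr rfl fun i _ => ?_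
    rw [Nat.testBit_succ]
    split_ifs
    · rw [← pow_add]
      congr 1
      ring
    · simp
  · simp

theorem mortonNumber_succ_div {d : ℕ} (w : ℕ) (p : Fin d → ℕ) :
    mortonNumber (w + 1) p / 2 ^ d = mortonNumber w (fun i => p i / 2) := by
  obtain ⟨s, hs, hsum, -⟩ := exists_finset_sum_two_pow fun i => (p i).testBit 0
  rw [mortonNumber_succ, hsum, Nat.add_comm, Nat.add_mul_div_right _ _ (by positivity),
    Nat.div_eq_of_lt (Nat.geomSum_lt le_rfl hs), zero_add]

theorem mortonNumber_div {d : ℕ} (k w : ℕ) (p : Fin d → ℕ) :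
    mortonNumber (w + k) p / 2 ^ (d * k) = mortonNumber w (fun i => p i / 2 ^ k) := by
  induction k generalizing p with
  | zero => simp
  | succ k ih =>
    rw [mul_add, mul_one, Nat.add_comm (d * k), pow_add, ← Nat.div_div_eq_div_mul, ← add_assoc,
      mortonNumber_succ_div, ih]
    simp only [Nat.div_div_eq_div_mul, pow_succ']

theorem mortonNumber_injective {d : ℕ} {w : ℕ} {p q : Fin d → ℕ} (hp : ∀ i, p i < 2 ^ w)
    (hq : ∀ i, q i < 2 ^ w) (h : mortonNumber w p = mortonNumber w q) : p = q := by
  induction w generalizing p q with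
  | zero =>
    funext i
    have := hp i
    have := hq i
    omega
  | succ w ih =>
    have h1 : mortonNumber w (fun i => p i / 2) = mortonNumber w (fun i => q i / 2) := by
      rw [← mortonNumber_succ_div, ← mortonNumber_succ_div, h]
    have h2 := ih (fun i => by have := hp i; rw [pow_succ] at this; omega)
      (fun i => by have := hq i; rw [pow_succ] at this; omega) h1
    rw [mortonNumber_succ, mortonNumber_succ, h1, Nat.add_left_cancel_iff] at h
    obtain ⟨s, -, hs, hs'⟩ := exists_finset_sum_two_pow fun i => (p i).testBit 0
    obtain ⟨t, -, ht, ht'⟩ := exists_finset_sum_two_pow fun i => (q i).testBit 0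
    have hst : s = t := Finset.geomSum_injective le_rfl (hs.symm.trans (h.trans ht))
    funext i
    have h3 : (p i).testBit 0 = true ↔ (q i).testBit 0 = true := by rw [← hs', ← ht', hst]
    have h4 := congrFun h2 i
    simp only [Nat.testBit_zero, decide_eq_true_eq] at h3 h4
    omega

/-- The points of a square are contiguous in the Morton order. -/
theorem div_eq_of_mortonNumber_between {d w k : ℕ} (hk : k ≤ w) {p q r : Fin d → ℕ}
    (hp : ∀ i, p i < 2 ^ w) (hq : ∀ i, q i < 2 ^ w)
    (hpq : mortonNumber w p ≤ mortonNumber w q) (hqr : mortonNumber w q ≤ mortonNumber w r)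
    (h : ∀ i, p i / 2 ^ k = r i / 2 ^ k) (i : Fin d) : p i / 2 ^ k = q i / 2 ^ k := by
  obtain ⟨v, rfl⟩ : ∃ v, w = v + k := ⟨w - k, by omega⟩
  have h1 := Nat.div_le_div_right (c := 2 ^ (d * k)) hpq
  have h2 := Nat.div_le_div_right (c := 2 ^ (d * k)) hqr
  rw [mortonNumber_div, mortonNumber_div] at h1 h2
  rw [← funext h] at h2
  have hlt : ∀ x, x < 2 ^ (v + k) → x / 2 ^ k < 2 ^ v := fun x hx => by
    rwa [Nat.div_lt_iff_lt_mul (by positivity), ← pow_add]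
  exact congrFun (mortonNumber_injective (fun i => hlt _ (hp i)) (fun i => hlt _ (hq i))
    (le_antisymm h1 h2)) i

section MortonSort

variable {d w : ℕ} {P : Finset (Fin d → ℕ)}

theorem mortonSort_perm : (mortonSort w P).Perm P.toList := List.mergeSort_perm _ _

theorem mem_mortonSort {p : Fin d → ℕ} : p ∈ mortonSort w P ↔ p ∈ P := by
  rw [mortonSort_perm.mem_iff, Finset.mem_toList]

theorem length_mortonSort : (mortonSort w P).length = P.card := by
  rw [mortonSort_perm.length_eq, Finset.length_toList]

theorem nodup_mortonSort : (mortonSort w P).Nodup := mortonSort_perm.nodup_iff.2 P.nodup_toList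

theorem pairwise_mortonSort :
    (mortonSort w P).Pairwise fun p q => mortonNumber w p ≤ mortonNumber w q := by
  have := List.pairwise_mergeSort
    (le := fun p q : Fin d → ℕ => decide (mortonNumber w p ≤ mortonNumber w q))
    (fun a b c h1 h2 => by simp only [decide_eq_true_eq] at *; omega)
    (fun a b => by simp only [Bool.or_eq_true, decide_eq_true_eq]; omega) P.toList
  simpa [mortonSort] using this

end MortonSort

/-! ### The cost of an entry -/

/-- The least height `m` at which `p` and `q` lie in a common square of side `2 ^ m`, that is, the
height of their lowest common ancestor in the trie. -/
noncomputable def commonHeight {d : ℕ} (p q : Fin d → ℕ) : ℕ :=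
  sInf {m | ∀ i, p i / 2 ^ m = q i / 2 ^ m}

theorem mem_common_of_lt_two_pow {d w : ℕ} {p q : Fin d → ℕ} (hp : ∀ i, p i < 2 ^ w)
    (hq : ∀ i, q i < 2 ^ w) : w ∈ {m | ∀ i, p i / 2 ^ m = q i / 2 ^ m} := fun i => by
  rw [Nat.div_eq_of_lt (hp i), Nat.div_eq_of_lt (hq i)]

theorem commonHeight_le {d m : ℕ} {p q : Fin d → ℕ} (h : ∀ i, p i / 2 ^ m = q i / 2 ^ m) :
    commonHeight p q ≤ m := Nat.sInf_le h

theorem div_commonHeight {d w : ℕ} {p q : Fin d → ℕ} (hp : ∀ i, p i < 2 ^ w)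
    (hq : ∀ i, q i < 2 ^ w) (i : Fin d) :
    p i / 2 ^ commonHeight p q = q i / 2 ^ commonHeight p q :=
  Nat.sInf_mem (s := {m | ∀ i, p i / 2 ^ m = q i / 2 ^ m}) ⟨w, mem_common_of_lt_two_pow hp hq⟩ i

/-- Rounding does not touch the bits from `m` upwards, and these agree. -/
theorem size_shifted_xor_le {d : ℕ} (γ : ℕ) {h h' m : ℕ} (hh : h ≤ m) (hh' : h' ≤ m)
    {p q : Fin d → ℕ} (j : Fin d) (hpq : p j / 2 ^ m = q j / 2 ^ m) :
    ((roundPoint γ h' q j ^^^ roundPoint γ h p j) >>> (h' - γ)).size ≤ (m - h') + γ := by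
  refine Nat.size_le.2 (Nat.lt_pow_two_of_testBit _ fun i hi => ?_)
  have hbit : (p j).testBit (h' - γ + i) = (q j).testBit (h' - γ + i) := by
    have h1 := congrArg (fun x => x.testBit (h' - γ + i - m)) hpq
    simp only [Nat.testBit_div_two_pow] at h1
    rwa [show h' - γ + i - m + m = h' - γ + i by omega] at h1
  simp only [roundPoint, Nat.testBit_shiftRight, Nat.testBit_xor, Nat.testBit_shiftLeft]
  rw [show h - γ + (h' - γ + i - (h - γ)) = h' - γ + i by omega,
    show h' - γ + (h' - γ + i - (h' - γ)) = h' - γ + i by omega, hbit]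
  simp [show h - γ ≤ h' - γ + i by omega]

/-- An entry is charged to the levels between the two leaves and a common ancestor at height `m`:
both the height difference and the shifted xors have at most about that many bits. -/
theorem length_encodeNext_le {d : ℕ} (γ : ℕ) {h h' m : ℕ} (hh : h ≤ m) (hh' : h' ≤ m)
    {p q : Fin d → ℕ} (hpq : ∀ j, p j / 2 ^ m = q j / 2 ^ m) :
    (encodeNext γ (h, roundPoint γ h p) (h', roundPoint γ h' q)).length ≤
      2 * ((m - h) + (m - h')) + 2 + d * (2 * ((m - h') + γ) + 1) := by
  unfold encodeNext
  rw [List.length_append]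
  refine add_le_add ((length_gammaInt_le _).trans ?_) ?_
  · have h1 : ((h' : ℤ) - (h : ℤ)).natAbs.size ≤ (m - h) + (m - h') :=
      Nat.size_le.2 ((show _ ≤ (m - h) + (m - h') by omega).trans_lt Nat.lt_two_pow_self)
    simp only
    omega
  · refine (length_flatMap_le _ _ (2 * ((m - h') + γ) + 1) fun j _ => ?_).trans_eq (by simp)
    have h1 := size_shifted_xor_le γ hh hh' j (hpq j)
    have h2 := length_gammaNat_le
      ((roundPoint γ h' q j ^^^ roundPoint γ h p j) >>> (h' - γ))
    simp only
    omega

theorem sum_sub_eq_sum_card {ι : Type*} (s : Finset ι) (h m : ι → ℕ) (w : ℕ)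
    (hm : ∀ i ∈ s, m i ≤ w) : ∑ i ∈ s, (m i - h i) =
      ∑ k ∈ Finset.range w, (s.filter fun i => h i ≤ k ∧ k < m i).card := by
  have h1 : ∀ i ∈ s, m i - h i = ((Finset.range w).filter fun k => h i ≤ k ∧ k < m i).card := by
    intro i hi
    rw [← Nat.card_Ico]
    congr 1
    ext k
    have := hm i hi
    simp only [Finset.mem_Ico, Finset.mem_filter, Finset.mem_range]
    omega
  rw [Finset.sum_congr rfl h1]
  simp only [Finset.card_filter]
  exact Finset.sum_comm

/-! ### The total cost -/

/-- For consecutive points of the Morton order, consider the squares from the leaf of the earlier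
point up to just below the lowest common ancestor of both. At a fixed height these squares are
distinct for distinct pairs, and the nearest-neighbour distance of the point is at most of the order
of the size of the square, so `sum_card_levels_le` bounds their number. The same holds for the
leaves of the later points. -/
theorem sum_levels_le {d w : ℕ} {P : Finset (Fin d → ℕ)} {S : Set (EuclideanSpace ℝ (Fin d))}
    {ρ : ℝ} (hP : ∀ p ∈ P, ∀ i, p i < 2 ^ w) (hS : IsPreconnected S)
    (hPS : ∀ p ∈ P, toEuclid p ∈ S) (hws : WellSpaced S ρ P) (N : ℕ) (f : ℕ → Fin d → ℕ)
    (hf : ∀ i ≤ N, f i ∈ P) (hfinj : ∀ i < N, f i ≠ f (i + 1))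
    (hmono : ∀ i j, i ≤ j → j ≤ N → mortonNumber w (f i) ≤ mortonNumber w (f j)) :
    ((∑ i ∈ Finset.range N,
      (commonHeight (f i) (f (i + 1)) - leafHeight w P (f i)) : ℕ) : ℝ) ≤
        5 ^ d * w + 5 ^ d * (4 * |ρ| * (9 * d + 2)) * P.card ∧
    ((∑ i ∈ Finset.range N,
      (commonHeight (f i) (f (i + 1)) - leafHeight w P (f (i + 1))) : ℕ) : ℝ) ≤
        5 ^ d * w + 5 ^ d * (4 * |ρ| * (9 * d + 2)) * P.card := by
  rcases Nat.eq_zero_or_pos N with rfl | hN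
  · simp only [Finset.range_zero, Finset.sum_empty, Nat.cast_zero]
    constructor <;> positivity
  have hcard : 1 < P.card :=
    Finset.one_lt_card.2 ⟨f 0, hf 0 (by omega), f (0 + 1), hf (0 + 1) (by omega), hfinj 0 hN⟩
  obtain ⟨δ, hδ, hnear⟩ := exists_nearest hcard
  have hcell : ∀ p ∈ P, ∀ x ∈ voronoiCell S P p, dist x (toEuclid p) ≤ |ρ| * δ p := by
    intro p hp x hx
    obtain ⟨q, hq, hqp, hd⟩ := (hnear p hp).1
    have h1 := hws p hp x hx q hq hqp
    rw [hd, dist_comm] at h1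
    exact h1.trans (mul_le_mul_of_nonneg_right (le_abs_self ρ) (hδ p))
  have hleaf : ∀ p ∈ P, ∀ k < w, leafHeight w P p ≤ k → δ p ≤ (9 * d + 2) * 2 ^ k := by
    intro p hp k hk hle
    obtain ⟨q, hq, hqp, h1⟩ := exists_near_of_leafHeight_lt hp (hP p hp) (hle.trans_lt hk)
    have h2 := ((hnear p hp).2 q hq hqp).trans (dist_toEuclid_le h1)
    push_cast at h2
    have h3 : (2 : ℝ) ^ leafHeight w P p ≤ 2 ^ k := pow_le_pow_right₀ one_le_two hle
    have h4 : (d : ℝ) * (9 * 2 ^ leafHeight w P p) ≤ d * (9 * 2 ^ k) := by gcongr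
    have h5 : (0 : ℝ) < 2 ^ k := by positivity
    linarith
  have hm : ∀ i ∈ Finset.range N, commonHeight (f i) (f (i + 1)) ≤ w := fun i hi => by
    rw [Finset.mem_range] at hi
    exact commonHeight_le (mem_common_of_lt_two_pow (hP _ (hf i (by omega)))
      (hP _ (hf (i + 1) (by omega))))
  have hB : (2 : ℝ) ≤ 9 * d + 2 := by
    have : (0 : ℝ) ≤ d := by positivity
    linarith
  have hmem : ∀ {k : ℕ} {h : ℕ → ℕ} {i}, i ∈ (Finset.range N).filter
      (fun i => h i ≤ k ∧ k < commonHeight (f i) (f (i + 1))) →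
      i < N ∧ h i ≤ k ∧ k < commonHeight (f i) (f (i + 1)) := fun hi => by
    simpa using hi
  have hsep : ∀ i, ∀ k < commonHeight (f i) (f (i + 1)),
      ¬ ∀ c, f i c / 2 ^ k = f (i + 1) c / 2 ^ k := fun i k hk h =>
    absurd (commonHeight_le h) (not_le.2 hk)
  constructor
  · rw [sum_sub_eq_sum_card _ _ _ w hm]
    refine sum_card_levels_le hS hPS (abs_nonneg ρ) hδ (fun p hp => (hnear p hp).2) hcell hB w _ f
      (fun k _ i hi => hf i (hmem hi).1.le)
      (fun k hk i hi => hleaf _ (hf i (hmem hi).1.le) k hk (hmem hi).2.1) ?_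
    intro k hk
    -- By contiguity, `f (i + 1)` lies in the common square of `f i` and `f j`.
    have key : ∀ i j, i < j → j < N → k < commonHeight (f i) (f (i + 1)) →
        (∀ c, f i c / 2 ^ k = f j c / 2 ^ k) → False := fun i j hij hj hki h =>
      hsep i k hki (div_eq_of_mortonNumber_between hk.le (hP _ (hf i (by omega)))
        (hP _ (hf (i + 1) (by omega))) (hmono i (i + 1) (by omega) (by omega))
        (hmono (i + 1) j hij hj.le) h)
    intro i hi j hj h
    rcases lt_trichotomy i j with hij | hij | hij
    · exact (key i j hij (hmem hj).1 (hmem hi).2.2 h).elim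
    · exact hij
    · exact (key j i hij (hmem hi).1 (hmem hj).2.2 fun c => (h c).symm).elim
  · rw [sum_sub_eq_sum_card _ _ _ w hm]
    refine sum_card_levels_le hS hPS (abs_nonneg ρ) hδ (fun p hp => (hnear p hp).2) hcell hB w _
      (fun i => f (i + 1)) (fun k _ i hi => hf (i + 1) (hmem hi).1)
      (fun k hk i hi => hleaf _ (hf (i + 1) (hmem hi).1) k hk (hmem hi).2.1) ?_
    intro k hk
    -- By contiguity, `f j` lies in the common square of `f (i + 1)` and `f (j + 1)`.
    have key : ∀ i j, i < j → j < N → k < commonHeight (f j) (f (j + 1)) →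
        (∀ c, f (i + 1) c / 2 ^ k = f (j + 1) c / 2 ^ k) → False := by
      intro i j hij hj hkj h
      have h1 := div_eq_of_mortonNumber_between hk.le (hP _ (hf (i + 1) (by omega)))
        (hP _ (hf j (by omega))) (hmono (i + 1) j hij hj.le) (hmono j (j + 1) (by omega) hj) h
      exact hsep j k hkj fun c => (h1 c).symm.trans (h c)
    intro i hi j hj h
    rcases lt_trichotomy i j with hij | hij | hij
    · exact (key i j hij (hmem hj).1 (hmem hj).2.2 h).elim
    · exact hij
    · exact (key j i hij (hmem hi).1 (hmem hi).2.2 fun c => (h c).symm).elim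

theorem length_encodeArray {d : ℕ} (w γ : ℕ) (z : ℕ × (Fin d → ℕ))
    {l : List (ℕ × (Fin d → ℕ))} (hl : l ≠ []) :
    (encodeArray w γ l).length = w + d * w + ∑ i ∈ Finset.range (l.length - 1),
      (encodeNext γ (l.getD i z) (l.getD (i + 1) z)).length := by
  cases l with
  | nil => exact absurd rfl hl
  | cons a l =>
    rw [encodeArray, List.length_append, List.length_append, length_natBits,
      length_encodeTail γ l a z, List.length_flatMap]
    simp

theorem length_storedBits_le {d w : ℕ} (γ : ℕ) {P : Finset (Fin d → ℕ)}
    {S : Set (EuclideanSpace ℝ (Fin d))} {ρ : ℝ} (hP : ∀ p ∈ P, ∀ i, p i < 2 ^ w)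
    (hS : IsPreconnected S) (hPS : ∀ p ∈ P, toEuclid p ∈ S) (hws : WellSpaced S ρ P) :
    (storedBits w γ P).length ≤
      (1 + d + (4 + 2 * d) * ⌈(5 : ℝ) ^ d + 5 ^ d * (4 * |ρ| * (9 * d + 2))⌉₊ + (2 + 3 * d)) *
        (w + P.card * max γ 1) := by
  unfold storedBits roundedArray
  set L := mortonSort w P with hL
  let φ : (Fin d → ℕ) → ℕ × (Fin d → ℕ) := fun p =>
    (leafHeight w P p, roundPoint γ (leafHeight w P p) p)
  change (encodeArray w γ (L.map φ)).length ≤ _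
  by_cases hne : L = []
  · simp [hne, encodeArray]
  let f : ℕ → Fin d → ℕ := fun i => L.getD i 0
  have hlen : L.length = P.card := length_mortonSort
  have hpos : 0 < L.length := List.length_pos_iff.2 hne
  set N := L.length - 1 with hN
  have hfget : ∀ i (hi : i < L.length), f i = L[i] := fun i hi => by
    simp [f, List.getD_eq_getElem?_getD, hi]
  have hf : ∀ i ≤ N, f i ∈ P := fun i hi => by
    rw [hfget i (by omega)]
    exact mem_mortonSort.1 (List.getElem_mem _)
  have hfinj : ∀ i < N, f i ≠ f (i + 1) := fun i hi h => by
    rw [hfget i (by omega), hfget (i + 1) (by omega)] at h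
    have := (nodup_mortonSort (w := w) (P := P)).getElem_inj_iff.1 h
    omega
  have hmono : ∀ i j, i ≤ j → j ≤ N → mortonNumber w (f i) ≤ mortonNumber w (f j) := by
    intro i j hij hj
    rcases hij.eq_or_lt with rfl | hlt
    · exact le_rfl
    · rw [hfget i (by omega), hfget j (by omega)]
      exact List.pairwise_iff_getElem.1 pairwise_mortonSort i j _ _ hlt
  obtain ⟨hv, hu⟩ := sum_levels_le hP hS hPS hws N f hf hfinj hmono
  set E := ⌈(5 : ℝ) ^ d + 5 ^ d * (4 * |ρ| * (9 * d + 2))⌉₊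
  have hE : ∀ x : ℕ, (x : ℝ) ≤ 5 ^ d * w + 5 ^ d * (4 * |ρ| * (9 * d + 2)) * P.card →
      x ≤ E * (w + P.card) := by
    intro x hx
    have h1 : (5 : ℝ) ^ d + 5 ^ d * (4 * |ρ| * (9 * d + 2)) ≤ E := Nat.le_ceil _
    have h2 : (0 : ℝ) ≤ 5 ^ d := by positivity
    have h3 : (0 : ℝ) ≤ 5 ^ d * (4 * |ρ| * (9 * d + 2)) := by positivity
    have h4 : (x : ℝ) ≤ E * (w + P.card) := by
      rw [mul_add]
      refine hx.trans (add_le_add ?_ ?_) <;> gcongr <;> linarith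
    exact_mod_cast h4
  have hv' := hE _ hv
  have hu' := hE _ hu
  rw [length_encodeArray w γ (φ 0) (by simpa using hne), List.length_map, ← hN]
  have hterm : ∀ i ∈ Finset.range N,
      (encodeNext γ ((L.map φ).getD i (φ 0)) ((L.map φ).getD (i + 1) (φ 0))).length ≤
      2 * (commonHeight (f i) (f (i + 1)) - leafHeight w P (f i)) +
      (2 + 2 * d) * (commonHeight (f i) (f (i + 1)) - leafHeight w P (f (i + 1))) +
      (2 + d + 2 * d * γ) := by
    intro i hi
    rw [Finset.mem_range] at hi
    rw [List.getD_map, List.getD_map]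
    have hi0 := hf i (by omega)
    have hi1 := hf (i + 1) (by omega)
    have hd := div_commonHeight (hP _ hi0) (hP _ hi1)
    have h1 := leafHeight_le_of_div_eq hi0 (hP _ hi0) hi1 (hfinj i hi) hd
    have h2 := leafHeight_le_of_div_eq hi1 (hP _ hi1) hi0 (hfinj i hi).symm fun c => (hd c).symm
    refine (length_encodeNext_le γ h1 h2 hd).trans (le_of_eq ?_)
    ring
  have hsum := Finset.sum_le_sum hterm
  rw [Finset.sum_add_distrib, Finset.sum_add_distrib, ← Finset.mul_sum, ← Finset.mul_sum,
    Finset.sum_const, Finset.card_range, smul_eq_mul] at hsum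
  have hg1 : 1 ≤ max γ 1 := le_max_right _ _
  have hg2 : γ ≤ max γ 1 := le_max_left _ _
  set G := max γ 1
  have hNle : N ≤ P.card := by omega
  have h1 : N * (2 + d + 2 * d * γ) ≤ (2 + 3 * d) * (P.card * G) := by
    calc N * (2 + d + 2 * d * γ) ≤ P.card * (2 * G + d * G + 2 * d * G) := by
          gcongr
          · omega
          · exact Nat.le_mul_of_pos_right d hg1
      _ = _ := by ring
  have h2 : E * (w + P.card) ≤ E * (w + P.card * G) := by
    gcongr
    exact Nat.le_mul_of_pos_right _ hg1
  set T := w + P.card * G with hT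
  have h3 : P.card * G ≤ T := Nat.le_add_left _ _
  have h4 : w ≤ T := Nat.le_add_right _ _
  have h5 := Nat.mul_le_mul_left 2 (hv'.trans h2)
  have h6 := Nat.mul_le_mul_left (2 + 2 * d) (hu'.trans h2)
  have h7 := Nat.mul_le_mul_left (2 + 3 * d) h3
  have h8 := Nat.mul_le_mul_left (1 + d) h4
  nlinarith

theorem mainTheorem1 (d : ℕ) (ρ : ℝ) :
    ∃ C : ℕ, ∀ (w γ : ℕ) (S : Set (EuclideanSpace ℝ (Fin d))) (P : Finset (Fin d → ℕ)),
      1 ≤ w →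
      (∀ p ∈ P, ∀ i, p i < 2 ^ w) →
      IsPreconnected S →
      (∀ p ∈ P, toEuclid p ∈ S) →
      WellSpaced S ρ P →
      decodeArray d w γ (storedBits w γ P) = roundedArray w γ P ∧
      (storedBits w γ P).length ≤ C * (w + P.card * max γ 1) := by
  refine ⟨_, fun w γ S P hw hP hS hPS hws => ⟨?_, length_storedBits_le γ hP hS hPS hws⟩⟩
  have hround : ∀ x k : ℕ, (x >>> k) <<< k ≤ x := fun x k => by
    rw [Nat.shiftRight_eq_div_pow, Nat.shiftLeft_eq]
    exact Nat.div_mul_le_self x _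
  have hmem : ∀ a ∈ roundedArray w γ P, ∃ p ∈ P,
      a = (leafHeight w P p, roundPoint γ (leafHeight w P p) p) := fun a ha => by
    obtain ⟨p, hp, rfl⟩ := List.mem_map.1 ha
    exact ⟨p, mem_mortonSort.1 hp, rfl⟩
  refine decodeArray_encodeArray w γ hw _ (fun a ha => ?_) (fun a ha j => ?_) fun a ha j => ?_
  · obtain ⟨p, hp, rfl⟩ := hmem a ha
    exact (leafHeight_le hp (hP p hp)).trans_lt Nat.lt_two_pow_self
  · obtain ⟨p, hp, rfl⟩ := hmem a ha
    exact (hround _ _).trans_lt (hP p hp j)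
  · obtain ⟨p, hp, rfl⟩ := hmem a ha
    simp only [roundPoint, Nat.shiftLeft_shiftRight]
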